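/- Let $P$ be a multiplicative subsemigroup of $\mathbb N=\{1,2,3,\dots\}$ with $P\not\subseteq\{1\}$. Call an abelian group (or commutative monoid) $P$-torsion-free if $px=py$ implies $x=y$ for all $p\in P$ and all elements $x,y$. A partially ordered abelian group $G$ is called simple if it is directed and every $u>0$ in $G$ is an order-unit (for every $x\in G$ there is $n\in\mathbb N$ with $x\le nu$); it is a Riesz group if it is directed and has the interpolation property (whenever $a_0,a_1\le b_0,b_1$ there is $c$ with $a_0,a_1\le c\le b_0,b_1$). A commutative monoid is quasi-divisible if each of its elements has the form $2u+3v$ with $u,v$ in the monoid. Then for every simple $P$-torsion-free partially ordered abelian group $A$ there are a simple $P$-torsion-free Riesz group $B$ whose positive cone $B^+$ is quasi-divisible, and a group homomorphism $f\colon A\to B$ which is an order-embedding ($f(x)\le f(y)\iff x\le y$) with cofinal image (for every $b\in B$ there is $a\in A$ with $b\le f(a)$), such that $B/f(A)$ is torsion-free. -/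

import Mathlib

universe u

/-- `u` is an order-unit of the partially ordered abelian group `G`: it is positive and every
element of `G` lies below a positive multiple of `u`. -/
def IsOrderUnit {G : Type*} [AddCommGroup G] [PartialOrder G] (u : G) : Prop :=
  0 ≤ u ∧ ∀ x : G, ∃ n : ℕ, 0 < n ∧ x ≤ n • u

/-- A simple partially ordered abelian group: it is directed and every `u > 0` is an
order-unit.  (For a directed group this says that the only ideals, i.e. directed convex
subgroups, are `0` and the whole group.) -/
structure IsSimplePOGroup (G : Type*) [AddCommGroup G] [PartialOrder G] : Prop where
  directed : IsDirectedOrder G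
  orderUnit : ∀ u : G, 0 < u → IsOrderUnit u

/-- The interpolation property: if `a₀, a₁ ≤ b₀, b₁` then some `c` lies in between. -/
def HasInterpolation (G : Type*) [PartialOrder G] : Prop :=
  ∀ a₀ a₁ b₀ b₁ : G, a₀ ≤ b₀ → a₀ ≤ b₁ → a₁ ≤ b₀ → a₁ ≤ b₁ →
    ∃ c : G, a₀ ≤ c ∧ a₁ ≤ c ∧ c ≤ b₀ ∧ c ≤ b₁

/-- A Riesz group: a directed partially ordered abelian group with interpolation. -/
structure IsRieszGroup (G : Type*) [AddCommGroup G] [PartialOrder G] [IsOrderedAddMonoid G] :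
    Prop where
  directed : IsDirectedOrder G
  interpolation : HasInterpolation G

/-- `M` is `P`-torsion-free: `p x = p y` implies `x = y`, for all `p ∈ P`. Here `P` is a
multiplicative subsemigroup of the positive integers. -/
def IsPTorsionFree (P : Subsemigroup ℕ+) (M : Type*) [AddCommMonoid M] : Prop :=
  ∀ p ∈ P, ∀ x y : M, (p : ℕ) • x = (p : ℕ) • y → x = y

/-- A commutative monoid is quasi-divisible if every `x` can be written `2u + 3v`. -/
def IsQuasiDivisible (M : Type*) [AddCommMonoid M] : Prop :=
  ∀ x : M, ∃ u v : M, 2 • u + 3 • v = x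

/-!
If `A` is trivial, it is its own extension. Otherwise fix `e > 0` in `A`. The group `B` is the union
of a sequence `A = A₀ ⊆ A₁ ⊆ A₂ ⊆ ⋯` of simple groups in which `Aₙ₊₁` contains a solution of every
interpolation problem posed in `Aₙ` and of every equation `2u + 3v = x`, `u, v ≥ 0`, with `x ∈ Aₙ⁺`,
and in which the quotients `Aₙ₊₁ / Aₙ` are free.

Both kinds of problem amount to adjoining one free element `w`. For `a₀, a₁ ≤ b₀, b₁` it has to
satisfy `aᵢ ≤ w ≤ bⱼ`; for `x = 2u + 3v` put `u = 3w - x` and `v = x - 2w`, so that it has to satisfy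
`x ≤ 3w` and `2w ≤ x`. The least cone on `A ⊕ ℤw` with these inequalities restricts to the cone of
`A`, but its new elements need not be order-units. This is repaired by declaring
`∑ αᵢ gᵢ - m e` positive, where the `gᵢ` are the new generators, whenever `∑ αᵢ > N m`
(`generatedCone`). The inequality is strict, so a multiple of such an element is still above `e`.
For `N` large nothing new becomes positive in `A`: if `w` cancels from `∑ αᵢ gᵢ`, then this sum is a
combination of boundedly many strictly positive elements of `A` (the gaps `bⱼ - aᵢ`, or `x`), with
coefficients adding up to a fixed fraction of `∑ αᵢ`, hence it is above `m e`
(`exists_admissibleCone_interpolation`, `exists_admissibleCone_quasiDivisible`).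

Such one-element extensions amalgamate freely over `A`: sums of their cones, each with its own `w`,
remain conservative over `A` and simple because this can be tested one summand at a time
(`nonneg_of_mem_amalgamCone`, `exists_nsmul_sub_mem_amalgamCone`). Hence all problems are solved in
one step (`IsSimplePOGroup.exists_extension`), and `ω` steps suffice
(`IsSimplePOGroup.exists_riesz_extension`). An extension with torsion-free quotient has no torsion
outside `A`, so it is `P`-torsion-free as soon as `A` is.
-/

/-! ### Simplicity through a single order-unit -/

lemma isSimplePOGroup_of_unit {G : Type*} [AddCommGroup G] [PartialOrder G] [IsOrderedAddMonoid G]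
    (e : G) (he : 0 ≤ e) (hbdd : ∀ x : G, ∃ n : ℕ, x ≤ n • e)
    (hlarge : ∀ u : G, 0 < u → ∃ n : ℕ, e ≤ n • u) : IsSimplePOGroup G where
  directed := ⟨fun x y => by
    obtain ⟨m, hm⟩ := hbdd x
    obtain ⟨n, hn⟩ := hbdd y
    exact ⟨(m + n) • e, hm.trans (nsmul_le_nsmul_left he (by omega)),
      hn.trans (nsmul_le_nsmul_left he (by omega))⟩⟩
  orderUnit u hu := ⟨hu.le, fun x => by
    obtain ⟨m, hm⟩ := hbdd x
    obtain ⟨n, hn⟩ := hlarge u hu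
    refine ⟨m * n + 1, by omega, ?_⟩
    calc x ≤ m • e := hm
      _ ≤ m • n • u := nsmul_le_nsmul_right hn m
      _ = (m * n) • u := (mul_nsmul' u m n).symm
      _ ≤ (m * n + 1) • u := nsmul_le_nsmul_left hu.le (by omega)⟩

lemma IsSimplePOGroup.exists_pos {G : Type*} [AddCommGroup G] [PartialOrder G]
    [IsOrderedAddMonoid G] [Nontrivial G] (h : IsSimplePOGroup G) : ∃ e : G, 0 < e := by
  obtain ⟨x, hx⟩ := exists_ne (0 : G)
  obtain ⟨y, hxy, hy⟩ := h.directed.directed x 0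
  rcases hy.eq_or_lt with hy | hy
  · exact ⟨-x, neg_pos.2 (lt_of_le_of_ne (hy ▸ hxy) hx)⟩
  · exact ⟨y, hy⟩

/-- A cone for which every nonzero element has a multiple above the unit `j e` is automatically
pointed, because it does not contain `-j e`. -/
lemma exists_simple_order_of_cone {A G : Type*} [AddCommGroup A] [PartialOrder A]
    [IsOrderedAddMonoid A] [AddCommGroup G] (C : AddSubmonoid G) (j : A →+ G)
    (hj : ∀ a, j a ∈ C ↔ 0 ≤ a) {e : A} (he : 0 < e) (hbdd : ∀ x : G, ∃ K : ℕ, K • j e - x ∈ C)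
    (hlarge : ∀ x ∈ C, x ≠ 0 → ∃ K : ℕ, K • x - j e ∈ C) :
    ∃ (_ : PartialOrder G) (_ : IsOrderedAddMonoid G),
      IsSimplePOGroup G ∧ ∀ x y : G, x ≤ y ↔ y - x ∈ C := by
  let C' : AddGroupCone G :=
    { C with
      eq_zero_of_mem_of_neg_mem' := fun {x} hx hnx => by
        by_contra h0
        obtain ⟨K, hK⟩ := hlarge x hx h0
        have h := C.add_mem hK (C.nsmul_mem hnx K)
        rw [neg_nsmul, sub_add_eq_add_sub, add_neg_cancel, zero_sub, ← map_neg, hj] at h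
        exact he.not_ge (neg_nonneg.1 h) }
  let _ : PartialOrder G := PartialOrder.mkOfAddGroupCone C'
  have _ : IsOrderedAddMonoid G := IsOrderedAddMonoid.mkOfCone C'
  have le_iff : ∀ x y : G, x ≤ y ↔ y - x ∈ C := fun _ _ => Iff.rfl
  have nonneg_iff : ∀ x : G, 0 ≤ x ↔ x ∈ C := fun x => by rw [le_iff, sub_zero]
  exact ⟨inferInstance, inferInstance,
    isSimplePOGroup_of_unit (j e) ((nonneg_iff _).2 ((hj e).2 he.le)) hbdd
      fun u hu => hlarge u ((nonneg_iff u).1 hu.le) hu.ne', le_iff⟩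

/-! ### Adjoining one element -/

section OneElement

variable {A : Type*} [AddCommGroup A] [PartialOrder A]

/-- A cone `D` on `A × ℤ`, the group obtained from `A` by adjoining one free element, is admissible
for the unit `e` if it induces no more than the order of `A`, every element of `D` outside `A` has
a multiple above `e`, and the adjoined element lies between two multiples of `e`. Antisymmetry
follows from these conditions, and `D` need not contain the positive cone of `A`. -/
structure IsAdmissibleCone (e : A) (D : AddSubmonoid (A × ℤ)) : Prop where
  nonneg : ∀ a : A, (a, (0 : ℤ)) ∈ D → 0 ≤ a
  interior : ∀ (a : A) (n : ℤ), n ≠ 0 → (a, n) ∈ D → ∃ K : ℕ, (K • a - e, K • n) ∈ D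
  bddAbove : ∃ K : ℕ, (K • e, (-1 : ℤ)) ∈ D
  bddBelow : ∃ K : ℕ, (K • e, (1 : ℤ)) ∈ D

lemma IsAdmissibleCone.exists_nsmul_mem {e : A} {D : AddSubmonoid (A × ℤ)}
    (h : IsAdmissibleCone e D) (n : ℤ) : ∃ K : ℕ, (K • e, n) ∈ D := by
  obtain ⟨K, hK⟩ := h.bddAbove
  obtain ⟨L, hL⟩ := h.bddBelow
  obtain ⟨m, rfl | rfl⟩ := n.eq_nat_or_neg
  · refine ⟨m * L, ?_⟩
    have := D.nsmul_mem hL m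
    simpa [mul_nsmul'] using this
  · refine ⟨m * K, ?_⟩
    have := D.nsmul_mem hK m
    simpa [mul_nsmul'] using this

variable [IsOrderedAddMonoid A] {ι : Type*} [Fintype ι]

/-- The cone on `A × ℤ` consisting of the sums of a positive element of `A`, a combination
`∑ i, α i • g i`, and, if `∑ i, α i` exceeds `N * m`, a negative multiple `-m • e` of the unit. Thus
`e` lies below the multiple `(N + 1) • g i` of each `g i`, and the strictness of the inequality makes
the elements with `m ≠ 0` interior as well. -/
def generatedCone (e : A) (g : ι → A × ℤ) (N : ℕ) : AddSubmonoid (A × ℤ) where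
  carrier := {x | ∃ (α : ι → ℕ) (m : ℕ) (c : A), 0 ≤ c ∧ (m = 0 ∨ N * m < ∑ i, α i) ∧
    x = (c - m • e, 0) + ∑ i, α i • g i}
  zero_mem' := ⟨0, 0, 0, le_rfl, Or.inl rfl, by simp [← Prod.zero_eq_mk]⟩
  add_mem' := by
    rintro _ _ ⟨α, m, c, hc, h, rfl⟩ ⟨β, n, d, hd, h', rfl⟩
    refine ⟨α + β, m + n, c + d, add_nonneg hc hd, ?_, ?_⟩
    · simp only [Pi.add_apply, Finset.sum_add_distrib, mul_add]
      rcases h with rfl | h <;> rcases h' with rfl | h'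
      · exact Or.inl rfl
      all_goals right; omega
    · simp only [Pi.add_apply, add_nsmul, Finset.sum_add_distrib]
      rw [show (c + d - (m • e + n • e), (0 : ℤ)) = (c - m • e, 0) + (d - n • e, 0) by
        ext <;> simp; abel]
      abel

lemma mem_generatedCone [DecidableEq ι] (e : A) (g : ι → A × ℤ) (N : ℕ) (i : ι) :
    g i ∈ generatedCone e g N := by
  refine ⟨Pi.single i 1, 0, 0, le_rfl, Or.inl rfl, ?_⟩
  rw [Finset.sum_eq_single i (fun j _ hj => by simp [hj]) (by simp)]
  ext <;> simp

/-- The hypothesis `hg` says that the order of `A` already satisfies, with a margin, every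
consequence of `0 ≤ g i` in which the adjoined element cancels. -/
lemma isAdmissibleCone_generatedCone {e : A} (hbdd : ∀ x : A, ∃ n : ℕ, x ≤ n • e)
    (g : ι → A × ℤ) (N : ℕ)
    (hg : ∀ (α : ι → ℕ) (m : ℕ), ∑ i, (α i : ℤ) * (g i).2 = 0 → (m = 0 ∨ N * m < ∑ i, α i) →
      m • e ≤ ∑ i, α i • (g i).1)
    (hpos : ∃ α : ι → ℕ, ∑ i, (α i : ℤ) * (g i).2 = 1)
    (hneg : ∃ α : ι → ℕ, ∑ i, (α i : ℤ) * (g i).2 = -1) :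
    IsAdmissibleCone e (generatedCone e g N) where
  nonneg := by
    rintro a ⟨α, m, c, hc, h, ha⟩
    simp only [Prod.ext_iff, Prod.fst_add, Prod.snd_add, Prod.fst_sum, Prod.snd_sum,
      Prod.smul_fst, Prod.smul_snd, nsmul_eq_mul, zero_add] at ha
    rw [ha.1]
    have := hg α m ha.2.symm h
    rw [sub_add_eq_add_sub, add_sub_assoc]
    exact add_nonneg hc (sub_nonneg.2 this)
  interior := by
    rintro a n hn ⟨α, m, c, hc, h, ha⟩
    have hα : N * m < ∑ i, α i := by
      rcases h with rfl | h
      · rw [mul_zero, Nat.pos_iff_ne_zero]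
        intro h0
        rw [Finset.sum_eq_zero_iff] at h0
        refine hn ((congrArg Prod.snd ha).trans ?_)
        simp [fun i => h0 i (Finset.mem_univ i)]
      · exact h
    -- `N * m + 1 ≤ ∑ i, α i`, so after multiplication by `N + 1` there is room for one more `e`.
    refine ⟨N + 1, (N + 1) • α, (N + 1) * m + 1, (N + 1) • c, nsmul_nonneg hc _, Or.inr ?_, ?_⟩
    · simp only [Pi.smul_apply, smul_eq_mul, ← Finset.mul_sum]
      nlinarith
    · have h1 : (N + 1) • (a, n) = (N + 1) • ((c - m • e, (0 : ℤ)) + ∑ i, α i • g i) := by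
        rw [ha]
      rw [nsmul_add, Finset.smul_sum] at h1
      have h2 : ((N + 1) • a - e, (N + 1) • n) = (N + 1) • (a, n) - (e, (0 : ℤ)) := by
        ext <;> simp
      rw [h2, h1]
      simp only [Pi.smul_apply, smul_eq_mul, mul_nsmul']
      rw [add_sub_right_comm]
      congr 1
      ext
      · change (N + 1) • (c - m • e) - e = (N + 1) • c - ((N + 1) * m + 1) • e
        rw [nsmul_sub, succ_nsmul e, mul_nsmul', sub_sub]
      · simp
  bddAbove := by
    obtain ⟨α, hα⟩ := hneg
    obtain ⟨K, hK⟩ := hbdd (∑ i, α i • (g i).1)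
    refine ⟨K, α, 0, K • e - ∑ i, α i • (g i).1, sub_nonneg.2 hK, Or.inl rfl, ?_⟩
    ext
    · simp [Prod.fst_sum]
    · simp [Prod.snd_sum, hα]
  bddBelow := by
    obtain ⟨α, hα⟩ := hpos
    obtain ⟨K, hK⟩ := hbdd (∑ i, α i • (g i).1)
    refine ⟨K, α, 0, K • e - ∑ i, α i • (g i).1, sub_nonneg.2 hK, Or.inl rfl, ?_⟩
    ext
    · simp [Prod.fst_sum]
    · simp [Prod.snd_sum, hα]

/-- If `e` is below `k • d`, then a coefficient `t ≥ k * m` brings `t • d` above `m • e`. -/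
lemma nsmul_le_nsmul_of_unit_le {e d : A} {k m t : ℕ} (hd : 0 ≤ d) (hk : e ≤ k • d)
    (h : k * m ≤ t) : m • e ≤ t • d :=
  calc m • e ≤ m • k • d := nsmul_le_nsmul_right hk m
    _ = (k * m) • d := (mul_nsmul d k m).symm
    _ ≤ t • d := nsmul_le_nsmul_left hd h

/-- An interpolation problem with strict inequalities is solved by the adjoined element for some
admissible cone. -/
lemma exists_admissibleCone_interpolation {e : A} (hbdd : ∀ x : A, ∃ n : ℕ, x ≤ n • e)
    (hlarge : ∀ u : A, 0 < u → ∃ n : ℕ, e ≤ n • u) {a₀ a₁ b₀ b₁ : A}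
    (h₀₀ : a₀ < b₀) (h₀₁ : a₀ < b₁) (h₁₀ : a₁ < b₀) (h₁₁ : a₁ < b₁) :
    ∃ D : AddSubmonoid (A × ℤ), IsAdmissibleCone e D ∧ (-a₀, (1 : ℤ)) ∈ D ∧ (-a₁, (1 : ℤ)) ∈ D ∧
      (b₀, (-1 : ℤ)) ∈ D ∧ (b₁, (-1 : ℤ)) ∈ D := by
  have key : ∃ k : ℕ, e ≤ k • (b₀ - a₀) ∧ e ≤ k • (b₁ - a₀) ∧ e ≤ k • (b₀ - a₁) ∧
      e ≤ k • (b₁ - a₁) := by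
    rw [← sub_pos] at h₀₀ h₀₁ h₁₀ h₁₁
    obtain ⟨k₁, h₁⟩ := hlarge _ h₀₀
    obtain ⟨k₂, h₂⟩ := hlarge _ h₀₁
    obtain ⟨k₃, h₃⟩ := hlarge _ h₁₀
    obtain ⟨k₄, h₄⟩ := hlarge _ h₁₁
    exact ⟨k₁ + k₂ + k₃ + k₄, h₁.trans (nsmul_le_nsmul_left h₀₀.le (by omega)),
      h₂.trans (nsmul_le_nsmul_left h₀₁.le (by omega)),
      h₃.trans (nsmul_le_nsmul_left h₁₀.le (by omega)),
      h₄.trans (nsmul_le_nsmul_left h₁₁.le (by omega))⟩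
  obtain ⟨k, k₀₀, k₀₁, k₁₀, k₁₁⟩ := key
  -- If one of three nonnegative integers is at least `k * m`, the corresponding combination of
  -- gaps is above `m • e`.
  have three : ∀ {x y z : A} {m r s t : ℕ}, 0 < x → 0 < y → 0 < z → e ≤ k • x → e ≤ k • y →
      e ≤ k • z → (k * m ≤ r ∨ k * m ≤ s ∨ k * m ≤ t) → m • e ≤ r • x + s • y + t • z := by
    intro x y z m r s t hx hy hz kx ky kz h
    have hx' := nsmul_nonneg hx.le r
    have hy' := nsmul_nonneg hy.le s
    have hz' := nsmul_nonneg hz.le t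
    rcases h with h | h | h
    · exact (nsmul_le_nsmul_of_unit_le hx.le kx h).trans
        (by rw [add_assoc]; exact le_add_of_nonneg_right (add_nonneg hy' hz'))
    · exact (nsmul_le_nsmul_of_unit_le hy.le ky h).trans
        (le_add_of_le_of_nonneg (le_add_of_nonneg_left hx') hz')
    · exact (nsmul_le_nsmul_of_unit_le hz.le kz h).trans
        (le_add_of_nonneg_left (add_nonneg hx' hy'))
  -- When the adjoined element cancels, the gaps have total coefficient half of `∑ i, α i`; three
  -- gaps share it, so one of them has coefficient at least a sixth of `∑ i, α i`.
  let g : Fin 4 → A × ℤ := ![(-a₀, 1), (-a₁, 1), (b₀, -1), (b₁, -1)]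
  refine ⟨generatedCone e g (6 * k), isAdmissibleCone_generatedCone hbdd g _ ?_
    ⟨![1, 0, 0, 0], by simp [g, Fin.sum_univ_four]⟩
    ⟨![0, 0, 1, 0], by simp [g, Fin.sum_univ_four]⟩,
    mem_generatedCone e g _ 0, mem_generatedCone e g _ 1, mem_generatedCone e g _ 2,
    mem_generatedCone e g _ 3⟩
  intro α m h0 hm
  simp only [g, Fin.sum_univ_four, Fin.isValue, Matrix.cons_val_zero, Matrix.cons_val_one,
    Matrix.cons_val] at h0 hm ⊢
  have hm' : m = 0 ∨ 6 * (k * m) < α 0 + α 1 + α 2 + α 3 := by rwa [← mul_assoc]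
  -- A transport of the mass `α 0, α 1` at `a₀, a₁` to the mass `α 2, α 3` at `b₀, b₁` writes the
  -- right-hand side as a combination of three of the four gaps.
  rcases le_total (α 2) (α 0) with hle | hle
  · obtain ⟨r, hr⟩ := Nat.exists_eq_add_of_le hle
    have h3 : α 3 = r + α 1 := by omega
    have hgap : α 0 • -a₀ + α 1 • -a₁ + α 2 • b₀ + α 3 • b₁ =
        α 2 • (b₀ - a₀) + r • (b₁ - a₀) + α 1 • (b₁ - a₁) := by
      rw [hr, h3]; simp only [add_nsmul, nsmul_sub, neg_nsmul]; abel
    rw [hgap]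
    refine three (sub_pos.2 h₀₀) (sub_pos.2 h₀₁) (sub_pos.2 h₁₁) k₀₀ k₀₁ k₁₁ ?_
    rcases hm' with rfl | hm'
    · simp
    · omega
  · obtain ⟨r, hr⟩ := Nat.exists_eq_add_of_le hle
    have h3 : α 1 = r + α 3 := by omega
    have hgap : α 0 • -a₀ + α 1 • -a₁ + α 2 • b₀ + α 3 • b₁ =
        α 0 • (b₀ - a₀) + r • (b₀ - a₁) + α 3 • (b₁ - a₁) := by
      rw [hr, h3]; simp only [add_nsmul, nsmul_sub, neg_nsmul]; abel
    rw [hgap]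
    refine three (sub_pos.2 h₀₀) (sub_pos.2 h₁₀) (sub_pos.2 h₁₁) k₀₀ k₁₀ k₁₁ ?_
    rcases hm' with rfl | hm'
    · simp
    · omega

/-- For `0 < x` some admissible cone places the adjoined element `w` so that `x ≤ 3w` and `2w ≤ x`;
then `x = 2 (3w - x) + 3 (x - 2w)`. -/
lemma exists_admissibleCone_quasiDivisible {e : A} (hbdd : ∀ x : A, ∃ n : ℕ, x ≤ n • e)
    (hlarge : ∀ u : A, 0 < u → ∃ n : ℕ, e ≤ n • u) {x : A} (hx : 0 < x) :
    ∃ D : AddSubmonoid (A × ℤ), IsAdmissibleCone e D ∧ (-x, (3 : ℤ)) ∈ D ∧ (x, (-2 : ℤ)) ∈ D := by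
  obtain ⟨k, hk⟩ := hlarge x hx
  let g : Fin 2 → A × ℤ := ![(-x, 3), (x, -2)]
  refine ⟨generatedCone e g (5 * k), isAdmissibleCone_generatedCone hbdd g _ ?_
    ⟨![1, 1], by simp [g, Fin.sum_univ_two]⟩
    ⟨![1, 2], by simp [g, Fin.sum_univ_two]⟩,
    mem_generatedCone e g _ 0, mem_generatedCone e g _ 1⟩
  intro α m h0 hm
  simp only [g, Fin.sum_univ_two, Fin.isValue, Matrix.cons_val_zero, Matrix.cons_val_one]
    at h0 hm ⊢
  -- Cancellation of the adjoined element forces `α = (2t, 3t)`, with sum `5t`,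
  -- and the combination is `t • x`.
  obtain ⟨t, ht⟩ : ∃ t, α 1 = α 0 + t := ⟨α 1 - α 0, by omega⟩
  have hsum : α 0 • -x + α 1 • x = t • x := by
    rw [ht]; simp only [add_nsmul, neg_nsmul]; abel
  rw [hsum]
  refine nsmul_le_nsmul_of_unit_le hx.le hk ?_
  rcases hm with rfl | hm
  · simp
  · rw [mul_assoc] at hm
    omega

end OneElement

/-! ### Adjoining solutions of all problems simultaneously -/

section Amalgam

variable {A : Type u} [AddCommGroup A] [PartialOrder A]

/-- The group obtained from `A` by adjoining one free element for each admissible cone. -/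
abbrev AdmissibleExtension (e : A) : Type u :=
  A × ({D : AddSubmonoid (A × ℤ) // IsAdmissibleCone e D} →₀ ℤ)

/-- The sum of the values of a finitely supported function. -/
noncomputable def finsuppTotal (I A : Type*) [AddCommMonoid A] : (I →₀ A) →+ A :=
  Finsupp.liftAddHom fun _ => AddMonoidHom.id A

@[simp]
lemma finsuppTotal_single {I A : Type*} [AddCommMonoid A] (i : I) (a : A) :
    finsuppTotal I A (Finsupp.single i a) = a := by
  simp [finsuppTotal]

/-- The amalgam over `A` of all admissible cones, each on its own copy of `A × ℤ`: an element
`(a, s)` belongs to it if `a` dominates a sum of elements `b D` of `A` with `(b D, s D) ∈ D`. -/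
def amalgamCone [IsOrderedAddMonoid A] (e : A) : AddSubmonoid (AdmissibleExtension e) where
  carrier := {x | ∃ b : _ →₀ A, finsuppTotal _ A b ≤ x.1 ∧ ∀ D, (b D, x.2 D) ∈ D.1}
  zero_mem' := ⟨0, by simp, fun D => D.1.zero_mem⟩
  add_mem' := by
    rintro x y ⟨b, hb, hbD⟩ ⟨c, hc, hcD⟩
    exact ⟨b + c, by rw [map_add]; exact add_le_add hb hc, fun D => D.1.add_mem (hbD D) (hcD D)⟩

variable [IsOrderedAddMonoid A] {e : A}

lemma mem_amalgamCone_of_nonneg {a : A} (ha : 0 ≤ a) :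
    ((a, 0) : AdmissibleExtension e) ∈ amalgamCone e :=
  ⟨0, by simpa using ha, fun D => D.1.zero_mem⟩

lemma mem_amalgamCone_of_mem {D : {D : AddSubmonoid (A × ℤ) // IsAdmissibleCone e D}} {a : A}
    {n : ℤ} (h : (a, n) ∈ D.1) :
    ((a, Finsupp.single D n) : AdmissibleExtension e) ∈ amalgamCone e := by
  classical
  refine ⟨Finsupp.single D a, by simp, fun E => ?_⟩
  by_cases hE : D = E
  · subst hE; simpa using h
  · rw [Finsupp.single_eq_of_ne' hE, Finsupp.single_eq_of_ne' hE]; exact E.1.zero_mem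

lemma nonneg_of_mem_amalgamCone {a : A}
    (h : ((a, 0) : AdmissibleExtension e) ∈ amalgamCone e) : 0 ≤ a := by
  obtain ⟨b, hb, hbD⟩ := h
  exact (Finset.sum_nonneg fun D _ => D.2.nonneg (b D) (hbD D)).trans hb

/-- It is enough to gain `e` in one of the summands, a component in which the element is not in `A`;
an element with no such component lies in `A`. -/
lemma exists_nsmul_sub_mem_amalgamCone
    (hlarge : ∀ u : A, 0 < u → ∃ n : ℕ, e ≤ n • u) (x : AdmissibleExtension e)
    (hx : x ∈ amalgamCone e) (h0 : x ≠ 0) :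
    ∃ K : ℕ, K • x - (e, 0) ∈ amalgamCone e := by
  classical
  obtain ⟨a, s⟩ := x
  by_cases hs : s = 0
  · subst hs
    have ha : 0 < a := lt_of_le_of_ne (nonneg_of_mem_amalgamCone hx) fun h => h0 (by simp [← h])
    obtain ⟨K, hK⟩ := hlarge a ha
    refine ⟨K, ?_⟩
    simpa using mem_amalgamCone_of_nonneg (e := e) (sub_nonneg.2 hK)
  · obtain ⟨b, hb, hbD⟩ := hx
    obtain ⟨D, hD⟩ := Finsupp.ne_iff.1 hs
    obtain ⟨K, hK⟩ := D.2.interior (b D) (s D) hD (hbD D)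
    refine ⟨K, K • b - Finsupp.single D e, ?_, fun E => ?_⟩
    · rw [map_sub, map_nsmul, finsuppTotal_single]
      exact sub_le_sub_right (nsmul_le_nsmul_right hb K) e
    · by_cases hE : D = E
      · subst hE; simpa using hK
      · simpa [Finsupp.single_apply, hE] using E.1.nsmul_mem (hbD E) K

lemma exists_sub_mem_amalgamCone (hbdd : ∀ x : A, ∃ n : ℕ, x ≤ n • e)
    (x : AdmissibleExtension e) : ∃ K : ℕ, K • (e, 0) - x ∈ amalgamCone e := by
  obtain ⟨a, s⟩ := x
  have hs : ∃ K : ℕ, K • (e, 0) - (0, s) ∈ amalgamCone e := by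
    induction s using Finsupp.induction_linear with
    | zero => exact ⟨0, by rw [zero_nsmul]; simpa only [← Prod.zero_eq_mk, sub_zero] using
      (amalgamCone e).zero_mem⟩
    | add s t hs ht =>
      obtain ⟨K, hK⟩ := hs
      obtain ⟨L, hL⟩ := ht
      refine ⟨K + L, ?_⟩
      convert (amalgamCone e).add_mem hK hL using 1
      ext <;> simp [add_nsmul]; ring
    | single D n =>
      obtain ⟨K, hK⟩ := D.2.exists_nsmul_mem (-n)
      refine ⟨K, ?_⟩
      simpa using mem_amalgamCone_of_mem hK
  obtain ⟨K, hK⟩ := hs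
  obtain ⟨L, hL⟩ := hbdd a
  refine ⟨K + L, ?_⟩
  convert (amalgamCone e).add_mem hK (mem_amalgamCone_of_nonneg (sub_nonneg.2 hL)) using 1
  ext <;> simp [add_nsmul]; abel

/-- The amalgam of all admissible cones solves all interpolation and divisibility problems that
come from `A`. -/
lemma IsSimplePOGroup.exists_extension [Nontrivial A] (hA : IsSimplePOGroup A) :
    ∃ (B : Type u) (_ : AddCommGroup B) (_ : PartialOrder B) (_ : IsOrderedAddMonoid B)
      (f : A →+ B), IsSimplePOGroup B ∧ (∀ x, 0 ≤ f x ↔ 0 ≤ x) ∧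
      (∀ (n : ℕ) (b : B), n ≠ 0 → n • b ∈ f.range → b ∈ f.range) ∧
      (∀ a₀ a₁ b₀ b₁ : A, a₀ ≤ b₀ → a₀ ≤ b₁ → a₁ ≤ b₀ → a₁ ≤ b₁ →
        ∃ c : B, f a₀ ≤ c ∧ f a₁ ≤ c ∧ c ≤ f b₀ ∧ c ≤ f b₁) ∧
      (∀ x : A, 0 ≤ x → ∃ u v : B, 0 ≤ u ∧ 0 ≤ v ∧ 2 • u + 3 • v = f x) := by
  obtain ⟨e, he⟩ := hA.exists_pos
  have hbdd : ∀ x : A, ∃ n : ℕ, x ≤ n • e := fun x =>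
    let ⟨n, _, hn⟩ := (hA.orderUnit e he).2 x
    ⟨n, hn⟩
  have hlarge : ∀ u : A, 0 < u → ∃ n : ℕ, e ≤ n • u := fun u hu =>
    let ⟨n, _, hn⟩ := (hA.orderUnit u hu).2 e
    ⟨n, hn⟩
  let f : A →+ AdmissibleExtension e := AddMonoidHom.inl _ _
  have hf : ∀ x, f x ∈ amalgamCone e ↔ 0 ≤ x := fun x =>
    ⟨nonneg_of_mem_amalgamCone, mem_amalgamCone_of_nonneg⟩
  obtain ⟨o, om, hB, le_iff⟩ := exists_simple_order_of_cone (amalgamCone e) f hf he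
    (exists_sub_mem_amalgamCone hbdd) (exists_nsmul_sub_mem_amalgamCone hlarge)
  have hmono := fun (x y : A) (h : x ≤ y) =>
    (le_iff (f x) (f y)).2 (by rw [← map_sub, hf]; exact sub_nonneg.2 h)
  refine ⟨AdmissibleExtension e, inferInstance, o, om, f, hB,
    fun x => by rw [le_iff, sub_zero, hf], ?_, ?_, ?_⟩
  · rintro n ⟨a, s⟩ hn ⟨a', ha'⟩
    have hs : s = 0 := by
      have h2 : n • s = 0 := (congrArg Prod.snd ha').symm
      ext D
      have h3 : n • s D = 0 := DFunLike.congr_fun h2 D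
      simpa [hn] using h3
    exact ⟨a, by simp [f, hs]⟩
  · intro a₀ a₁ b₀ b₁ h₀₀ h₀₁ h₁₀ h₁₁
    rcases h₀₀.eq_or_lt with rfl | h₀₀'
    · exact ⟨f a₀, hmono _ _ le_rfl, hmono _ _ h₁₀, hmono _ _ le_rfl, hmono _ _ h₀₁⟩
    rcases h₀₁.eq_or_lt with rfl | h₀₁'
    · exact ⟨f a₀, hmono _ _ le_rfl, hmono _ _ h₁₁, hmono _ _ h₀₀, hmono _ _ le_rfl⟩
    rcases h₁₀.eq_or_lt with rfl | h₁₀'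
    · exact ⟨f a₁, hmono _ _ h₀₀, hmono _ _ le_rfl, hmono _ _ le_rfl, hmono _ _ h₁₁⟩
    rcases h₁₁.eq_or_lt with rfl | h₁₁'
    · exact ⟨f a₁, hmono _ _ h₀₁, hmono _ _ le_rfl, hmono _ _ h₁₀, hmono _ _ le_rfl⟩
    obtain ⟨D, hD, h1, h2, h3, h4⟩ :=
      exists_admissibleCone_interpolation hbdd hlarge h₀₀' h₀₁' h₁₀' h₁₁'
    refine ⟨(0, Finsupp.single ⟨D, hD⟩ 1), ?_, ?_, ?_, ?_⟩
    · simpa [le_iff, f] using mem_amalgamCone_of_mem (D := ⟨D, hD⟩) h1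
    · simpa [le_iff, f] using mem_amalgamCone_of_mem (D := ⟨D, hD⟩) h2
    · simpa [le_iff, f] using mem_amalgamCone_of_mem (D := ⟨D, hD⟩) h3
    · simpa [le_iff, f] using mem_amalgamCone_of_mem (D := ⟨D, hD⟩) h4
  · intro x hx
    have nonneg := fun (y : AdmissibleExtension e) (hy : y ∈ amalgamCone e) =>
      (le_iff 0 y).2 (by rwa [sub_zero])
    rcases hx.eq_or_lt with rfl | hx
    · exact ⟨0, 0, nonneg _ (zero_mem _), nonneg _ (zero_mem _), by simp⟩
    obtain ⟨D, hD, h1, h2⟩ := exists_admissibleCone_quasiDivisible hbdd hlarge hx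
    refine ⟨_, _, nonneg _ (mem_amalgamCone_of_mem (D := ⟨D, hD⟩) h1),
      nonneg _ (mem_amalgamCone_of_mem (D := ⟨D, hD⟩) h2), ?_⟩
    ext
    · simp only [f, Prod.fst_add, Prod.smul_fst, AddMonoidHom.inl_apply, neg_nsmul]
      abel
    · simp [f]

end Amalgam

/-! ### The union of a sequence of extensions -/

/-- A sequence of injective homomorphisms of abelian groups has a union. -/
lemma exists_union_of_injective (G : ℕ → Type u) [∀ n, AddCommGroup (G n)]
    (g : ∀ n, G n →+ G (n + 1)) (hg : ∀ n, Function.Injective (g n)) :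
    ∃ (L : Type u) (_ : AddCommGroup L) (j : ∀ n, G n →+ L),
      (∀ n, Function.Injective (j n)) ∧ (∀ n x, j (n + 1) (g n x) = j n x) ∧
      ∀ y, ∃ n x, j n x = y := by
  let t : ∀ m n : ℕ, m ≤ n → (G m →+ G n) := fun m n h =>
    Nat.leRecOn h (fun {k} φ => (g k).comp φ) (AddMonoidHom.id (G m))
  have t_self : ∀ m (x : G m), t m m le_rfl x = x := fun m x => by
    simp only [t, Nat.leRecOn_self, AddMonoidHom.id_apply]
  have t_succ : ∀ m n (h : m ≤ n) (x : G m), t m (n + 1) (h.trans n.le_succ) x = g n (t m n h x) :=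
    fun m n h x => by
      simp only [t]
      rw [Nat.leRecOn_succ h]
      rfl
  have t_trans : ∀ k m n (hkm : k ≤ m) (hmn : m ≤ n) (x : G k),
      t m n hmn (t k m hkm x) = t k n (hkm.trans hmn) x := by
    intro k m n hkm hmn x
    induction n, hmn using Nat.le_induction with
    | base => exact t_self _ _
    | succ n hmn ih => rw [t_succ m n hmn, t_succ k n (hkm.trans hmn), ih]
  have t_inj : ∀ m n (h : m ≤ n), Function.Injective (t m n h) := by
    intro m n h
    induction n, h using Nat.le_induction with
    | base => intro x y hxy; simpa only [t_self] using hxy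
    | succ n h ih =>
      intro x y hxy
      rw [t_succ m n h, t_succ m n h] at hxy
      exact ih (hg n hxy)
  have _ : DirectedSystem G fun m n h => t m n h := ⟨fun m x => t_self m x,
    fun k m n hmn hkm x => t_trans _ _ _ _ _ x⟩
  refine ⟨DirectLimit G t, inferInstance,
    fun n => AddMonoidHom.mk' (fun x => ⟦⟨n, x⟩⟧) fun x y => (DirectLimit.add_def n x y).symm,
    fun n => DirectLimit.mk_injective t t_inj n, fun n x => ?_, fun y => ?_⟩
  · have := DirectLimit.mk_apply (f := t) n (n + 1) x n.le_succ
    rw [t_succ n n le_rfl, t_self] at this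
    exact this
  · obtain ⟨n, x, rfl⟩ := DirectLimit.exists_eq_mk t y
    exact ⟨n, x, rfl⟩

/-- A nontrivial simple partially ordered abelian group, bundled so that extensions can be
iterated. -/
structure SimplePOGroup where
  carrier : Type u
  [group : AddCommGroup carrier]
  [order : PartialOrder carrier]
  [ordered : IsOrderedAddMonoid carrier]
  [nontrivial : Nontrivial carrier]
  simple : IsSimplePOGroup carrier

attribute [instance] SimplePOGroup.group SimplePOGroup.order SimplePOGroup.ordered
  SimplePOGroup.nontrivial

lemma injective_of_nonneg_iff {A B : Type*} [AddCommGroup A] [PartialOrder A]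
    [AddCommGroup B] [PartialOrder B] {f : A →+ B}
    (h : ∀ x, 0 ≤ f x ↔ 0 ≤ x) [IsOrderedAddMonoid A] : Function.Injective f := by
  rw [injective_iff_map_eq_zero]
  intro x hx
  refine le_antisymm (neg_nonneg.1 ((h _).1 ?_)) ((h _).1 hx.ge)
  rw [map_neg, hx, neg_zero]

lemma le_iff_of_nonneg_iff {A B : Type*} [AddCommGroup A] [PartialOrder A]
    [AddCommGroup B] [PartialOrder B] [IsOrderedAddMonoid A] [IsOrderedAddMonoid B] {f : A →+ B}
    (h : ∀ x, 0 ≤ f x ↔ 0 ≤ x) (x y : A) : f x ≤ f y ↔ x ≤ y := by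
  rw [← sub_nonneg, ← map_sub, h, sub_nonneg]

/-- A nontrivial simple group embeds in a simple Riesz group with quasi-divisible positive cone,
with torsion-free quotient: iterate the one-step extension and take the union. -/
lemma IsSimplePOGroup.exists_riesz_extension {A : Type u} [AddCommGroup A] [PartialOrder A]
    [IsOrderedAddMonoid A] [Nontrivial A] (hA : IsSimplePOGroup A) :
    ∃ (B : Type u) (_ : AddCommGroup B) (_ : PartialOrder B) (_ : IsOrderedAddMonoid B)
      (f : A →+ B), IsSimplePOGroup B ∧ (∀ x, 0 ≤ f x ↔ 0 ≤ x) ∧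
      (∀ (n : ℕ) (b : B), n ≠ 0 → n • b ∈ f.range → b ∈ f.range) ∧
      HasInterpolation B ∧ ∀ x : B, 0 ≤ x → ∃ u v : B, 0 ≤ u ∧ 0 ≤ v ∧ 2 • u + 3 • v = x := by
  have step : ∀ G : SimplePOGroup.{u}, ∃ (H : SimplePOGroup.{u}) (f : G.carrier →+ H.carrier),
      (∀ x, 0 ≤ f x ↔ 0 ≤ x) ∧
      (∀ (n : ℕ) (b : H.carrier), n ≠ 0 → n • b ∈ f.range → b ∈ f.range) ∧
      (∀ a₀ a₁ b₀ b₁ : G.carrier, a₀ ≤ b₀ → a₀ ≤ b₁ → a₁ ≤ b₀ → a₁ ≤ b₁ →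
        ∃ c : H.carrier, f a₀ ≤ c ∧ f a₁ ≤ c ∧ c ≤ f b₀ ∧ c ≤ f b₁) ∧
      (∀ x : G.carrier, 0 ≤ x → ∃ u v : H.carrier, 0 ≤ u ∧ 0 ≤ v ∧ 2 • u + 3 • v = f x) := by
    intro G
    obtain ⟨B, _, _, _, f, hB, hf, h⟩ := G.simple.exists_extension
    have : Nontrivial B := (injective_of_nonneg_iff hf).nontrivial
    exact ⟨⟨B, hB⟩, f, hf, h⟩
  choose next f hf htor hint hdiv using step
  let S : ℕ → SimplePOGroup.{u} := fun n =>
    Nat.rec (motive := fun _ => SimplePOGroup.{u}) ⟨A, hA⟩ (fun _ G => next G) n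
  let g : ∀ n : ℕ, (S n).carrier →+ (S (n + 1)).carrier := fun n => f (S n)
  have hg : ∀ n (x : (S n).carrier), 0 ≤ g n x ↔ 0 ≤ x := fun n => hf (S n)
  obtain ⟨L, _, j, j_inj, j_succ, j_surj⟩ := exists_union_of_injective (fun n => (S n).carrier) g
    fun n => injective_of_nonneg_iff (hg n)
  -- Every element lives in all sufficiently late stages, where it has the same sign.
  have lift : ∀ m n, m ≤ n → ∀ x : (S m).carrier, ∃ y : (S n).carrier,
      j n y = j m x ∧ (0 ≤ y ↔ 0 ≤ x) := by
    intro m n h x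
    induction n, h using Nat.le_induction with
    | base => exact ⟨x, rfl, Iff.rfl⟩
    | succ n h ih =>
      obtain ⟨y, hy, hy'⟩ := ih
      exact ⟨g n y, (j_succ n y).trans hy, (hg n y).trans hy'⟩
  have j_surj' : ∀ m y, ∃ n, m ≤ n ∧ ∃ x, j n x = y := by
    intro m y
    obtain ⟨k, x, rfl⟩ := j_surj y
    obtain ⟨z, hz, -⟩ := lift k (max m k) (le_max_right _ _) x
    exact ⟨max m k, le_max_left _ _, z, hz⟩
  have sign : ∀ m n (x : (S m).carrier) (y : (S n).carrier), j m x = j n y → 0 ≤ x → 0 ≤ y := by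
    intro m n x y h hx
    obtain ⟨x', hx', hx''⟩ := lift m (max m n) (le_max_left _ _) x
    obtain ⟨y', hy', hy''⟩ := lift n (max m n) (le_max_right _ _) y
    rw [← hx', ← hy'] at h
    rw [j_inj _ h] at hx''
    exact hy''.1 (hx''.2 hx)
  let C : AddSubmonoid L :=
    { carrier := {y | ∃ n x, j n x = y ∧ 0 ≤ x}
      zero_mem' := ⟨0, (0 : (S 0).carrier), map_zero (j 0), le_rfl⟩
      add_mem' := by
        rintro _ _ ⟨m, x, rfl, hx⟩ ⟨n, y, rfl, hy⟩
        obtain ⟨x', hx', hx''⟩ := lift m (max m n) (le_max_left _ _) x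
        obtain ⟨y', hy', hy''⟩ := lift n (max m n) (le_max_right _ _) y
        exact ⟨_, x' + y', by rw [map_add, hx', hy'], add_nonneg (hx''.2 hx) (hy''.2 hy)⟩ }
  have hC : ∀ n (x : (S n).carrier), j n x ∈ C ↔ 0 ≤ x := fun n x =>
    ⟨fun ⟨m, y, hy, hy'⟩ => sign m n y x hy hy', fun hx => ⟨n, x, rfl, hx⟩⟩
  have hj_range : ∀ n (b : ℕ) (y : (S n).carrier), b ≠ 0 → b • j n y ∈ (j 0).range →
      j n y ∈ (j 0).range := by
    intro n
    induction n with
    | zero => exact fun b y _ _ => ⟨y, rfl⟩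
    | succ n ih =>
      rintro b y hb ⟨a, ha⟩
      obtain ⟨a', ha', -⟩ := lift 0 n n.zero_le a
      have hy : b • y ∈ (g n).range := ⟨a', j_inj _
        (((j_succ n a').trans (ha'.trans ha)).trans (map_nsmul (j (n + 1)) b y).symm)⟩
      obtain ⟨z, rfl⟩ := htor (S n) b y hb hy
      have hz : j (n + 1) (f (S n) z) = j n z := j_succ n z
      rw [hz] at ha ⊢
      exact ih b z hb ⟨a, ha⟩
  obtain ⟨e, he⟩ := hA.exists_pos
  have hj_unit : ∀ n, ∃ e' : (S n).carrier, j n e' = j 0 e ∧ 0 < e' := fun n => by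
    obtain ⟨e', he', hs⟩ := lift 0 n n.zero_le e
    refine ⟨e', he', lt_of_le_of_ne (hs.2 he.le) ?_⟩
    rintro rfl
    rw [map_zero] at he'
    exact he.ne (j_inj 0 ((map_zero _).trans he'))
  have hbdd : ∀ y : L, ∃ K : ℕ, K • j 0 e - y ∈ C := by
    intro y
    obtain ⟨n, x, rfl⟩ := j_surj y
    obtain ⟨e', he', hpos⟩ := hj_unit n
    obtain ⟨K, -, hK⟩ := ((S n).simple.orderUnit e' hpos).2 x
    refine ⟨K, ?_⟩
    rwa [← he', ← map_nsmul, ← map_sub, hC, sub_nonneg]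
  have hlarge : ∀ y ∈ C, y ≠ 0 → ∃ K : ℕ, K • y - j 0 e ∈ C := by
    rintro _ ⟨n, x, rfl, hx⟩ h0
    obtain ⟨e', he', -⟩ := hj_unit n
    have hx' : 0 < x := lt_of_le_of_ne hx fun h => h0 (by rw [← h, map_zero])
    obtain ⟨K, -, hK⟩ := ((S n).simple.orderUnit x hx').2 e'
    refine ⟨K, ?_⟩
    rwa [← he', ← map_nsmul, ← map_sub, hC, sub_nonneg]
  obtain ⟨_, _, hL, le_iff⟩ := exists_simple_order_of_cone C (j 0) (hC 0) he hbdd hlarge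
  have hj : ∀ n (x : (S n).carrier), 0 ≤ j n x ↔ 0 ≤ x := fun n x => by rw [le_iff, sub_zero, hC]
  have hj_le : ∀ n (x y : (S n).carrier), j n x ≤ j n y ↔ x ≤ y := fun n =>
    le_iff_of_nonneg_iff (hj n)
  refine ⟨L, inferInstance, inferInstance, inferInstance, j 0, hL, hj 0, ?_, ?_, ?_⟩
  · intro b y hb hy
    obtain ⟨n, x, rfl⟩ := j_surj y
    exact hj_range n b x hb hy
  · intro a₀ a₁ b₀ b₁ h₀₀ h₀₁ h₁₀ h₁₁
    obtain ⟨n₁, -, x₁, rfl⟩ := j_surj' 0 a₀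
    obtain ⟨n₂, hn₂, x₂, rfl⟩ := j_surj' n₁ a₁
    obtain ⟨n₃, hn₃, x₃, rfl⟩ := j_surj' n₂ b₀
    obtain ⟨n, hn, x₄, rfl⟩ := j_surj' n₃ b₁
    obtain ⟨y₁, hy₁, -⟩ := lift n₁ n (by omega) x₁
    obtain ⟨y₂, hy₂, -⟩ := lift n₂ n (by omega) x₂
    obtain ⟨y₃, hy₃, -⟩ := lift n₃ n (by omega) x₃
    rw [← hy₁, ← hy₃, hj_le] at h₀₀
    rw [← hy₁, hj_le] at h₀₁
    rw [← hy₂, ← hy₃, hj_le] at h₁₀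
    rw [← hy₂, hj_le] at h₁₁
    rw [← hy₁, ← hy₂, ← hy₃]
    obtain ⟨c, hc⟩ := hint (S n) _ _ _ _ h₀₀ h₀₁ h₁₀ h₁₁
    refine ⟨j (n + 1) c, ?_⟩
    rw [← j_succ n y₁, ← j_succ n y₂, ← j_succ n y₃, ← j_succ n x₄]
    simpa only [hj_le] using hc
  · intro y hy
    obtain ⟨n, x, rfl⟩ := j_surj y
    obtain ⟨u, v, hu, hv, huv⟩ := hdiv (S n) x ((hj n x).1 hy)
    refine ⟨j (n + 1) u, j (n + 1) v, (hj _ _).2 hu, (hj _ _).2 hv, ?_⟩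
    rw [← j_succ n x, ← map_nsmul, ← map_nsmul, ← map_add]
    exact congrArg _ huv

/-! ### The embedding theorem -/

lemma isAddTorsionFree_quotient {B : Type*} [AddCommGroup B] (H : AddSubgroup B)
    (h : ∀ (n : ℕ) (b : B), n ≠ 0 → n • b ∈ H → b ∈ H) : IsAddTorsionFree (B ⧸ H) where
  nsmul_right_injective n hn x y hxy := by
    induction x using QuotientAddGroup.induction_on with | H x
    induction y using QuotientAddGroup.induction_on with | H y
    rw [QuotientAddGroup.eq]
    refine h n _ hn ?_
    have hxy' : ((n • x : B) : B ⧸ H) = (n • y : B) := hxy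
    rw [QuotientAddGroup.eq] at hxy'
    rwa [nsmul_add, neg_nsmul]

lemma isQuasiDivisible_nonneg {B : Type*} [AddCommGroup B] [PartialOrder B] [IsOrderedAddMonoid B]
    (h : ∀ x : B, 0 ≤ x → ∃ u v : B, 0 ≤ u ∧ 0 ≤ v ∧ 2 • u + 3 • v = x) :
    IsQuasiDivisible (AddSubmonoid.nonneg B) := by
  rintro ⟨x, hx⟩
  obtain ⟨u, v, hu, hv, huv⟩ := h x hx
  exact ⟨⟨u, hu⟩, ⟨v, hv⟩, Subtype.ext huv⟩

/-- Torsion of an extension with torsion-free quotient lies in the base. -/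
lemma IsPTorsionFree.of_range {P : Subsemigroup ℕ+} {A B : Type*} [AddCommGroup A] [AddCommGroup B]
    (hA : IsPTorsionFree P A) {f : A →+ B} (hf : Function.Injective f)
    (h : ∀ (n : ℕ) (b : B), n ≠ 0 → n • b ∈ f.range → b ∈ f.range) : IsPTorsionFree P B := by
  intro p hp x y hxy
  have h0 : (p : ℕ) • (x - y) = 0 := by rw [nsmul_sub, hxy, sub_self]
  obtain ⟨a, ha⟩ := h p (x - y) p.ne_zero (h0 ▸ zero_mem _)
  have ha0 : a = 0 := hA p hp a 0 (hf (by rw [map_nsmul, ha, h0, nsmul_zero, map_zero]))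
  rw [ha0, map_zero] at ha
  exact sub_eq_zero.1 ha.symm

theorem corollary3p12 (P : Subsemigroup ℕ+) (hP : ∃ p ∈ P, p ≠ 1)
    (A : Type u) [AddCommGroup A] [PartialOrder A] [IsOrderedAddMonoid A]
    (hA : IsSimplePOGroup A) (hAP : IsPTorsionFree P A) :
    ∃ (B : Type u) (_ : AddCommGroup B) (_ : PartialOrder B) (_ : IsOrderedAddMonoid B)
      (f : A →+ B),
      -- `f` is an embedding of partially ordered groups with cofinal image
      (∀ x y : A, f x ≤ f y ↔ x ≤ y) ∧ IsCofinal (Set.range f) ∧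
      IsSimplePOGroup B ∧ IsRieszGroup B ∧ IsPTorsionFree P B ∧
      IsQuasiDivisible (AddSubmonoid.nonneg B) ∧
      IsAddTorsionFree (B ⧸ f.range) := by
  rcases subsingleton_or_nontrivial A with _ | _
  · refine ⟨A, inferInstance, inferInstance, inferInstance, AddMonoidHom.id A, fun _ _ => Iff.rfl,
      fun x => ⟨x, ⟨x, rfl⟩, le_rfl⟩, hA, ⟨hA.directed, fun a _ _ _ _ _ _ _ => ?_⟩, hAP,
      isQuasiDivisible_nonneg fun x _ => ⟨0, 0, le_rfl, le_rfl, Subsingleton.elim _ _⟩,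
      isAddTorsionFree_quotient _ fun _ b _ _ => ⟨b, rfl⟩⟩
    exact ⟨a, (Subsingleton.elim _ _).le, (Subsingleton.elim _ _).le,
      (Subsingleton.elim _ _).le, (Subsingleton.elim _ _).le⟩
  · obtain ⟨B, _, _, _, f, hB, hf, htor, hint, hdiv⟩ := hA.exists_riesz_extension
    have hinj := injective_of_nonneg_iff hf
    refine ⟨B, inferInstance, inferInstance, inferInstance, f, le_iff_of_nonneg_iff hf,
      fun b => ?_, hB, ⟨hB.directed, hint⟩, hAP.of_range hinj htor,
      isQuasiDivisible_nonneg hdiv, isAddTorsionFree_quotient _ htor⟩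
    obtain ⟨e, he⟩ := hA.exists_pos
    have hfe : 0 < f e := lt_of_le_of_ne ((hf e).2 he.le) fun h =>
      he.ne (hinj ((map_zero f).trans h))
    obtain ⟨n, -, hn⟩ := (hB.orderUnit (f e) hfe).2 b
    exact ⟨f (n • e), ⟨n • e, rfl⟩, by rwa [map_nsmul]⟩
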